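/- Let $(X,\mu)$ be a standard Borel space with a $\sigma$-finite measure, and let $\mathcal{B}(L^2(X))$ be the algebra of bounded operators on the complex Hilbert space $L^2(X,\mu)$, with its weak* topology as the dual of the space of trace-class operators. For $a\in L^\infty(X,\mu)$ let $M_a$ be the operator of multiplication by $a$ on $L^2(X)$. A linear subspace $\mathcal{U}\subseteq\mathcal{B}(L^2(X))$ is called a masa-bimodule if $M_aTM_b\in\mathcal{U}$ for all $T\in\mathcal{U}$ and all $a,b\in L^\infty(X,\mu)$. A weak* closed masa-bimodule is called a bimodule of uniqueness if it contains no nonzero compact operator. If $\mathcal{U},\mathcal{V}\subseteq\mathcal{B}(L^2(X))$ are bimodules of uniqueness, then the weak* closure $\overline{\mathcal{U}+\mathcal{V}}^{w^*}$ is also a bimodule of uniqueness (in particular, a weak* closed masa-bimodule). -/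

import Mathlib

open MeasureTheory
open scoped ENNReal InnerProductSpace

noncomputable section

namespace MasaBimodule

section WeakStar

variable {H : Type*} [NormedAddCommGroup H] [InnerProductSpace ℂ H]

/-- A square summable sequence stays square summable under a bounded operator. -/
theorem memℓp_map (T : H →L[ℂ] H) (f : lp (fun _ : ℕ => H) 2) :
    Memℓp (fun i => T (f i)) 2 := by
  have h := (lp.memℓp f).summable (by norm_num)
  refine memℓp_gen ?_
  have h2 : Summable fun i => ‖T‖ ^ (2 : ℝ≥0∞).toReal * ‖f i‖ ^ (2 : ℝ≥0∞).toReal :=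
    h.mul_left _
  refine Summable.of_nonneg_of_le (fun i => by positivity) (fun i => ?_) h2
  rw [← Real.mul_rpow (norm_nonneg _) (norm_nonneg _)]
  exact Real.rpow_le_rpow (norm_nonneg _) (T.le_opNorm _) (by norm_num)

/-- The series defining the trace-class functionals converges. -/
theorem summable_pairing (T : H →L[ℂ] H) (f g : lp (fun _ : ℕ => H) 2) :
    Summable fun i => ⟪g i, T (f i)⟫_ℂ :=
  lp.summable_inner (𝕜 := ℂ) g (⟨fun i => T (f i), memℓp_map T f⟩ : lp (fun _ : ℕ => H) 2)

/-- The functional `T ↦ ∑ i, (T f_i, g_i)` on `B(H)` given by two square summable sequences.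
These are exactly the functionals coming from the predual (the trace-class operators, that is,
the projective tensor product of `H` with its conjugate). Mathlib's inner product is linear in
its second argument. -/
def pairing (p : lp (fun _ : ℕ => H) 2 × lp (fun _ : ℕ => H) 2) : (H →L[ℂ] H) →ₗ[ℂ] ℂ where
  toFun T := ∑' i, ⟪p.2 i, T (p.1 i)⟫_ℂ
  map_add' S T := by
    simp only [add_apply, inner_add_right]
    exact (summable_pairing S p.1 p.2).tsum_add (summable_pairing T p.1 p.2)
  map_smul' c T := by
    simp only [smul_apply, inner_smul_right, RingHom.id_apply, smul_eq_mul]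
    exact tsum_mul_left

/-- All the functionals of the predual together, as a linear map into a product of lines. -/
def pairingAll : (H →L[ℂ] H) →ₗ[ℂ] (lp (fun _ : ℕ => H) 2 × lp (fun _ : ℕ => H) 2 → ℂ) :=
  LinearMap.pi pairing

/-- The weak* topology on `B(H)`: the coarsest topology for which all the functionals of the
predual are continuous. -/
abbrev weakStar (H : Type*) [NormedAddCommGroup H] [InnerProductSpace ℂ H] :
    TopologicalSpace (H →L[ℂ] H) :=
  TopologicalSpace.induced (pairingAll (H := H)) Pi.topologicalSpace

/-- The weak* closure of a subspace of `B(H)`, as a subspace. -/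
def weakStarClosure (U : Submodule ℂ (H →L[ℂ] H)) : Submodule ℂ (H →L[ℂ] H) :=
  letI : TopologicalSpace (H →L[ℂ] H) := weakStar H
  haveI : ContinuousAdd (H →L[ℂ] H) := continuousAdd_induced (pairingAll (H := H))
  haveI : ContinuousSMul ℂ (H →L[ℂ] H) := continuousSMul_induced (pairingAll (H := H))
  U.topologicalClosure

theorem coe_weakStarClosure (U : Submodule ℂ (H →L[ℂ] H)) :
    (weakStarClosure U : Set (H →L[ℂ] H)) = @closure _ (weakStar H) (U : Set (H →L[ℂ] H)) :=
  rfl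

end WeakStar

section Bimodules

variable {X : Type*} [MeasurableSpace X] (μ : Measure X)

/-- The multiplication operator `M_a ξ = a ξ` on `L²(X, μ)`, for `a ∈ L^∞(X, μ)`. -/
def mulOp (a : Lp ℂ ∞ μ) : Lp ℂ 2 μ →L[ℂ] Lp ℂ 2 μ :=
  (ContinuousLinearMap.lsmul ℂ ℂ).holderL μ ∞ 2 2 a

theorem coeFn_mulOp (a : Lp ℂ ∞ μ) (ξ : Lp ℂ 2 μ) :
    mulOp μ a ξ =ᵐ[μ] fun x => a x * ξ x :=
  ContinuousLinearMap.coeFn_holder _ a ξ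

/-- A subspace `U` of `B(L²(X, μ))` is a masa-bimodule if `M_a T M_b ∈ U` for all `T ∈ U` and
all `a, b ∈ L^∞(X, μ)`. -/
def IsMasaBimodule (U : Submodule ℂ (Lp ℂ 2 μ →L[ℂ] Lp ℂ 2 μ)) : Prop :=
  ∀ T ∈ U, ∀ a b : Lp ℂ ∞ μ, mulOp μ a ∘L T ∘L mulOp μ b ∈ U

/-- A weak* closed masa-bimodule. -/
structure IsWeakStarClosedMasaBimodule (U : Submodule ℂ (Lp ℂ 2 μ →L[ℂ] Lp ℂ 2 μ)) : Prop where
  isMasaBimodule : IsMasaBimodule μ U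
  isClosed : @IsClosed _ (weakStar (Lp ℂ 2 μ)) (U : Set (Lp ℂ 2 μ →L[ℂ] Lp ℂ 2 μ))

/-- A bimodule of multiplicity: a weak* closed masa-bimodule whose intersection with the
compact operators is nonzero. -/
structure IsBimoduleOfMultiplicity (U : Submodule ℂ (Lp ℂ 2 μ →L[ℂ] Lp ℂ 2 μ)) : Prop
    extends IsWeakStarClosedMasaBimodule μ U where
  inf_compact_ne_bot : U ⊓ compactOperator (RingHom.id ℂ) (Lp ℂ 2 μ) (Lp ℂ 2 μ) ≠ ⊥

/-- A bimodule of uniqueness: a weak* closed masa-bimodule which is not a bimodule of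
multiplicity. -/
structure IsBimoduleOfUniqueness (U : Submodule ℂ (Lp ℂ 2 μ →L[ℂ] Lp ℂ 2 μ)) : Prop
    extends IsWeakStarClosedMasaBimodule μ U where
  not_multiplicity : ¬ IsBimoduleOfMultiplicity μ U

end Bimodules

end MasaBimodule

end

noncomputable section

namespace MasaBimodule

open Filter Topology

/-! ### Predual functionals and the bipolar theorem for subspaces. -/

section Predual

variable {H : Type*} [NormedAddCommGroup H] [InnerProductSpace ℂ H]

/-! Let `K` be compact in the weak* closure of `U + V`. Since `U` has no nonzero compact operator,
it suffices that `K ∈ U`, that is (bipolar theorem), that every predual functional `p(T) = ∑ ⟪g_i, T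
f_i⟫` annihilating `U` annihilates `K`.

The functional is turned into a Schur multiplication. Write `f_i = c_i f'_i` with `c_i → 0` and `f'`
still square summable. Truncate `f'` and `g` to sets of finite measure where their square functions
are at most `n`, and put `Φ_n(T) = ∑ c_i M_{g_i}* T M_{f'_i}`. Because `c_i → 0`, this series
converges in norm, so `Φ_n` preserves compactness and maps `V` into `V`. Its transpose acts on the
predual, so it is weak* continuous. Its matrix coefficients between indicator functions are values
of `p` on cutoffs of `T`, so it kills `U`. Hence `Φ_n(K)` is a compact element of `V`, so it is
zero. Thus `p` vanishes on the cutoffs of `K` to the level sets, and `n → ∞` gives `p(K) = 0`.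

The main steps are `hasSum_schurTerm`, `exists_pairing_schur`, `inner_schur_truncation` and
`pairing_eq_zero_of_isCompactOperator`. -/

omit [InnerProductSpace ℂ H] in
theorem memℓp_two_of_summable {f : ℕ → H} (hf : Summable fun i => ‖f i‖ ^ 2) :
    Memℓp f 2 :=
  memℓp_gen (by simpa using hf)

omit [InnerProductSpace ℂ H] in
theorem summable_norm_sq_lp (f : lp (fun _ : ℕ => H) 2) : Summable fun i => ‖f i‖ ^ 2 := by
  simpa using (lp.memℓp f).summable (by norm_num)

theorem hasSum_pairing (p : lp (fun _ : ℕ => H) 2 × lp (fun _ : ℕ => H) 2) (T : H →L[ℂ] H) :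
    HasSum (fun i => ⟪p.2 i, T (p.1 i)⟫_ℂ) (pairing p T) :=
  (summable_pairing T p.1 p.2).hasSum

/-- Square summable families over any countably infinite index type define functionals of the
predual. -/
theorem exists_pairing_of_equiv {ι : Type*} (e : ι ≃ ℕ) {f g : ι → H}
    (hf : Summable fun i => ‖f i‖ ^ 2) (hg : Summable fun i => ‖g i‖ ^ 2) :
    ∃ p, ∀ T : H →L[ℂ] H, HasSum (fun i => ⟪g i, T (f i)⟫_ℂ) (pairing p T) := by
  have hf' : Summable fun n => ‖f (e.symm n)‖ ^ 2 := hf.comp_injective e.symm.injective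
  have hg' : Summable fun n => ‖g (e.symm n)‖ ^ 2 := hg.comp_injective e.symm.injective
  let p : lp (fun _ : ℕ => H) 2 × lp (fun _ : ℕ => H) 2 :=
    (⟨fun n => f (e.symm n), memℓp_two_of_summable hf'⟩,
      ⟨fun n => g (e.symm n), memℓp_two_of_summable hg'⟩)
  refine ⟨p, fun T => ?_⟩
  have h : HasSum (fun n => ⟪g (e.symm n), T (f (e.symm n))⟫_ℂ) (pairing p T) := hasSum_pairing p T
  have h2 := (Equiv.hasSum_iff e).2 h
  simpa only [Function.comp_def, Equiv.symm_apply_apply] using h2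

theorem exists_pairing_add (p q : lp (fun _ : ℕ => H) 2 × lp (fun _ : ℕ => H) 2) :
    ∃ r, ∀ T : H →L[ℂ] H, pairing r T = pairing p T + pairing q T := by
  obtain ⟨r, hr⟩ := exists_pairing_of_equiv Equiv.natSumNatEquivNat
    (f := Sum.elim (fun i => p.1 i) fun i => q.1 i) (g := Sum.elim (fun i => p.2 i) fun i => q.2 i)
    (Summable.sum _ (summable_norm_sq_lp p.1) (summable_norm_sq_lp q.1))
    (Summable.sum _ (summable_norm_sq_lp p.2) (summable_norm_sq_lp q.2))
  exact ⟨r, fun T => (hr T).unique (HasSum.sum (hasSum_pairing p T) (hasSum_pairing q T))⟩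

theorem exists_pairing_smul (c : ℂ) (p : lp (fun _ : ℕ => H) 2 × lp (fun _ : ℕ => H) 2) :
    ∃ r, ∀ T : H →L[ℂ] H, pairing r T = c * pairing p T := by
  refine ⟨(c • p.1, p.2), fun T => (hasSum_pairing _ T).unique ?_⟩
  simpa [inner_smul_right] using (hasSum_pairing p T).mul_left c

theorem exists_pairing_sum {ι : Type*} (s : Finset ι) (c : ι → ℂ)
    (p : ι → lp (fun _ : ℕ => H) 2 × lp (fun _ : ℕ => H) 2) :
    ∃ r, ∀ T : H →L[ℂ] H, pairing r T = ∑ i ∈ s, c i * pairing (p i) T := by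
  classical
  induction s using Finset.induction_on with
  | empty =>
    obtain ⟨r, hr⟩ := exists_pairing_smul (H := H) 0 (0, 0)
    exact ⟨r, fun T => by simp [hr]⟩
  | insert i s hi ih =>
    obtain ⟨q, hq⟩ := ih
    obtain ⟨q', hq'⟩ := exists_pairing_smul (c i) (p i)
    obtain ⟨r, hr⟩ := exists_pairing_add q' q
    exact ⟨r, fun T => by rw [hr, hq, hq', Finset.sum_insert hi]⟩

theorem continuous_pairing (p : lp (fun _ : ℕ => H) 2 × lp (fun _ : ℕ => H) 2) :
    @Continuous _ _ (weakStar H) _ (pairing p) := by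
  let : TopologicalSpace (H →L[ℂ] H) := weakStar H
  exact (continuous_apply p).comp (continuous_induced_dom (f := pairingAll (H := H)))

/-- The bipolar theorem for subspaces: the weak* closure of `U` is the annihilator of the
preannihilator of `U`. -/
theorem mem_weakStarClosure_iff {U : Submodule ℂ (H →L[ℂ] H)} {T : H →L[ℂ] H} :
    T ∈ weakStarClosure U ↔ ∀ p, (∀ S ∈ U, pairing p S = 0) → pairing p T = 0 := by
  constructor
  · intro hT p hp
    let : TopologicalSpace (H →L[ℂ] H) := weakStar H
    have hcl : IsClosed {S : H →L[ℂ] H | pairing p S = 0} :=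
      isClosed_singleton.preimage (continuous_pairing p)
    exact closure_minimal (fun S hS => hp S hS) hcl hT
  · intro h
    rw [← SetLike.mem_coe, coe_weakStarClosure]
    let : TopologicalSpace (H →L[ℂ] H) := weakStar H
    rw [mem_closure_iff_nhds]
    intro t ht
    rw [nhds_induced, nhds_pi, Filter.mem_comap] at ht
    obtain ⟨t', ht', htt⟩ := ht
    obtain ⟨I, hI, w, hw, hIw⟩ := Filter.mem_pi.1 ht'
    have := hI.fintype
    let R : (H →L[ℂ] H) →ₗ[ℂ] (I → ℂ) := LinearMap.pi fun i => pairing i.1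
    -- A basic neighbourhood sees only the finitely many functionals in `I`. If `R T` were outside
    -- `R(U)`, some `φ` on `ℂ^I` would separate them, and `φ ∘ R` is again a predual functional,
    -- contradicting `h`.
    have hR : R T ∈ U.map R := by
      by_contra hn
      obtain ⟨φ, hφ, hle⟩ := Submodule.exists_le_ker_of_notMem hn
      classical
      obtain ⟨r, hr⟩ := exists_pairing_sum (H := H) (Finset.univ : Finset I)
        (fun i => φ fun j => if i = j then 1 else 0) (fun i => i.1)
      have key : ∀ S, pairing r S = φ (R S) := fun S => by
        rw [hr, LinearMap.pi_apply_eq_sum_univ φ (R S)]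
        exact Finset.sum_congr rfl fun i _ => mul_comm _ _
      refine hφ ?_
      rw [← key]
      exact h r fun S hS => (key S).trans (hle ⟨S, hS, rfl⟩)
    obtain ⟨S, hS, hST⟩ := hR
    refine ⟨S, htt (hIw fun i hi => ?_), hS⟩
    have : pairing i S = pairing i T := congrFun hST ⟨i, hi⟩
    change pairing i S ∈ w i
    rw [this]
    exact mem_of_mem_nhds (hw i)

theorem mem_of_isClosed_weakStar {U : Submodule ℂ (H →L[ℂ] H)}
    (hU : @IsClosed _ (weakStar H) (U : Set (H →L[ℂ] H))) {T : H →L[ℂ] H}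
    (h : ∀ p, (∀ S ∈ U, pairing p S = 0) → pairing p T = 0) : T ∈ U := by
  have := mem_weakStarClosure_iff.2 h
  rwa [← SetLike.mem_coe, coe_weakStarClosure,
    @IsClosed.closure_eq _ (weakStar H) _ hU] at this

theorem isClosed_weakStarClosure (U : Submodule ℂ (H →L[ℂ] H)) :
    @IsClosed _ (weakStar H) (weakStarClosure U : Set (H →L[ℂ] H)) := by
  rw [coe_weakStarClosure]
  exact @isClosed_closure _ (weakStar H) _

omit [InnerProductSpace ℂ H] in
theorem summable_norm_mul_norm (p : lp (fun _ : ℕ => H) 2 × lp (fun _ : ℕ => H) 2) :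
    Summable fun i => ‖p.1 i‖ * ‖p.2 i‖ := by
  refine Summable.of_nonneg_of_le (fun _ => by positivity) (fun i => ?_)
    ((summable_norm_sq_lp p.1).add (summable_norm_sq_lp p.2))
  nlinarith [sq_nonneg (‖p.1 i‖ - ‖p.2 i‖), sq_nonneg ‖p.1 i‖, sq_nonneg ‖p.2 i‖]

theorem norm_inner_apply_le (T : H →L[ℂ] H) (u v : H) :
    ‖⟪v, T u⟫_ℂ‖ ≤ ‖T‖ * (‖u‖ * ‖v‖) :=
  calc _ ≤ ‖v‖ * (‖T‖ * ‖u‖) :=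
        (norm_inner_le_norm _ _).trans (by gcongr; exact T.le_opNorm _)
    _ = _ := by ring

/-- The functionals of the predual are norm continuous. -/
theorem continuous_pairing_norm (p : lp (fun _ : ℕ => H) 2 × lp (fun _ : ℕ => H) 2) :
    Continuous (pairing p) := by
  refine (LinearMap.mkContinuous (pairing p) (∑' i, ‖p.1 i‖ * ‖p.2 i‖) fun T => ?_).continuous
  rw [mul_comm]
  exact tsum_of_norm_bounded ((summable_norm_mul_norm p).hasSum.mul_left ‖T‖) fun i =>
    norm_inner_apply_le T _ _

theorem pairing_eq_zero_of_hasSum (p : lp (fun _ : ℕ => H) 2 × lp (fun _ : ℕ => H) 2)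
    {S : ℕ → H →L[ℂ] H} {T : H →L[ℂ] H} (h : HasSum S T) (hS : ∀ i, pairing p (S i) = 0) :
    pairing p T = 0 := by
  have h1 := h.map (pairing p) (continuous_pairing_norm p)
  simp only [Function.comp_def, hS] at h1
  exact h1.unique hasSum_zero

end Predual

/-! ### Schur multiplications with null coefficients. -/

section Schur

variable {H : Type*} [NormedAddCommGroup H] [InnerProductSpace ℂ H]

/-- A sequence of operators with `∑ i, ‖A_i ξ‖² ≤ C ‖ξ‖²` for all `ξ`. -/
def IsBessel (A : ℕ → H →L[ℂ] H) (C : ℝ) : Prop :=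
  ∀ (s : Finset ℕ) (ξ : H), ∑ i ∈ s, ‖A i ξ‖ ^ 2 ≤ C * ‖ξ‖ ^ 2

theorem IsBessel.summable {A : ℕ → H →L[ℂ] H} {C : ℝ} (hA : IsBessel A C) (ξ : H) :
    Summable fun i => ‖A i ξ‖ ^ 2 :=
  summable_of_sum_le (fun _ => by positivity) fun s => hA s ξ

theorem IsBessel.summable_prod {A : ℕ → H →L[ℂ] H} {C : ℝ} (hA : IsBessel A C)
    {f : ℕ → H} (hf : Summable fun i => ‖f i‖ ^ 2) :
    Summable fun x : ℕ × ℕ => ‖A x.2 (f x.1)‖ ^ 2 := by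
  refine (summable_prod_of_nonneg fun _ => by positivity).2 ⟨fun j => hA.summable (f j), ?_⟩
  exact Summable.of_nonneg_of_le (fun j => tsum_nonneg fun _ => by positivity)
    (fun j => (hA.summable (f j)).tsum_le_of_sum_le fun s => hA s (f j)) (hf.mul_left C)

variable [CompleteSpace H]

/-- The terms `c_i B_i* T A_i` of a Schur multiplication. -/
def schurTerm (c : ℕ → ℝ) (A B : ℕ → H →L[ℂ] H) (T : H →L[ℂ] H) (i : ℕ) : H →L[ℂ] H :=
  (c i : ℂ) • ((B i).adjoint ∘L T ∘L A i)

/-- The Schur multiplication `T ↦ ∑ i, c_i B_i* T A_i`. -/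
def schur (c : ℕ → ℝ) (A B : ℕ → H →L[ℂ] H) (T : H →L[ℂ] H) : H →L[ℂ] H :=
  ∑' i, schurTerm c A B T i

variable {c : ℕ → ℝ} {A B : ℕ → H →L[ℂ] H} {C D : ℝ}

theorem inner_schurTerm (T : H →L[ℂ] H) (i : ℕ) (u v : H) :
    ⟪v, schurTerm c A B T i u⟫_ℂ = ⟪B i v, T ((c i : ℂ) • A i u)⟫_ℂ := by
  simp [schurTerm, ContinuousLinearMap.adjoint_inner_right]

/-- Testing the sum against its own value `w` at `u` lets Cauchy–Schwarz and the two Bessel bounds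
apply; a bound on the coefficients passes to the operator norm. -/
theorem norm_sum_schurTerm_le (hA : IsBessel A C) (hB : IsBessel B D)
    (T : H →L[ℂ] H) {ε : ℝ} (hε : 0 ≤ ε) (s : Finset ℕ) (hs : ∀ i ∈ s, |c i| ≤ ε) :
    ‖∑ i ∈ s, schurTerm c A B T i‖ ≤ ε * (‖T‖ * (√C * √D)) := by
  refine ContinuousLinearMap.opNorm_le_bound _ (by positivity) fun u => ?_
  set w := (∑ i ∈ s, schurTerm c A B T i) u with hw
  have hterm : ∀ i ∈ s, ‖⟪w, schurTerm c A B T i u⟫_ℂ‖ ≤ ε * ‖T‖ * (‖A i u‖ * ‖B i w‖) := by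
    intro i hi
    rw [inner_schurTerm, map_smul, inner_smul_right, norm_mul]
    calc _ ≤ ε * (‖T‖ * (‖A i u‖ * ‖B i w‖)) := by
          gcongr
          · simpa using hs i hi
          · exact norm_inner_apply_le T _ _
      _ = _ := by ring
  have h2 : ‖w‖ ^ 2 ≤ ε * ‖T‖ * (√C * √D * (‖u‖ * ‖w‖)) := by
    calc ‖w‖ ^ 2 = ‖⟪w, w⟫_ℂ‖ := by rw [inner_self_eq_norm_sq_to_K]; simp
      _ = ‖∑ i ∈ s, ⟪w, schurTerm c A B T i u⟫_ℂ‖ := by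
          rw [← inner_sum]; congr 2; simp [hw]
      _ ≤ ∑ i ∈ s, ε * ‖T‖ * (‖A i u‖ * ‖B i w‖) := norm_sum_le_of_le _ hterm
      _ = ε * ‖T‖ * ∑ i ∈ s, ‖A i u‖ * ‖B i w‖ := by rw [Finset.mul_sum]
      _ ≤ ε * ‖T‖ * (√(C * ‖u‖ ^ 2) * √(D * ‖w‖ ^ 2)) := by
          gcongr
          refine (Real.sum_mul_le_sqrt_mul_sqrt _ _ _).trans ?_
          gcongr
          · exact hA s u
          · exact hB s w
      _ = _ := by
          rw [Real.sqrt_mul' _ (by positivity), Real.sqrt_mul' _ (by positivity),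
            Real.sqrt_sq (norm_nonneg _), Real.sqrt_sq (norm_nonneg _)]
          ring
  rcases (norm_nonneg w).eq_or_lt with h0 | h0
  · rw [← h0]; positivity
  · refine le_of_mul_le_mul_right ?_ h0
    calc ‖w‖ * ‖w‖ = ‖w‖ ^ 2 := by ring
      _ ≤ _ := h2
      _ = _ := by ring

theorem hasSum_schurTerm (hA : IsBessel A C) (hB : IsBessel B D) (hc : Tendsto c atTop (𝓝 0))
    (T : H →L[ℂ] H) : HasSum (schurTerm c A B T) (schur c A B T) := by
  refine Summable.hasSum (summable_iff_vanishing_norm.2 fun ε hε => ?_)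
  -- The `+ 1` makes `M` positive and the final inequality strict.
  set M := ‖T‖ * (√C * √D) + 1 with hM
  have hM0 : 0 < M := by positivity
  obtain ⟨N, hN⟩ := Metric.tendsto_atTop.1 hc (ε / M) (by positivity)
  refine ⟨Finset.range N, fun t ht => ?_⟩
  have h1 : ∀ i ∈ t, |c i| ≤ ε / M := fun i hi => by
    have : N ≤ i := by
      have := Finset.disjoint_left.1 ht hi
      simpa using this
    simpa using (hN i this).le
  calc _ ≤ ε / M * (‖T‖ * (√C * √D)) := norm_sum_schurTerm_le hA hB T (by positivity) t h1
    _ < ε / M * M := by gcongr; simp [hM]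
    _ = ε := by field_simp

theorem hasSum_inner_schur (hA : IsBessel A C) (hB : IsBessel B D) (hc : Tendsto c atTop (𝓝 0))
    (T : H →L[ℂ] H) (u v : H) :
    HasSum (fun i => ⟪B i v, T ((c i : ℂ) • A i u)⟫_ℂ) ⟪v, schur c A B T u⟫_ℂ := by
  have h := (hasSum_schurTerm hA hB hc T).mapL
    ((innerSL ℂ v).comp (ContinuousLinearMap.apply ℂ H u))
  simpa [inner_schurTerm] using h

theorem isCompactOperator_schur (hA : IsBessel A C) (hB : IsBessel B D)
    (hc : Tendsto c atTop (𝓝 0)) {T : H →L[ℂ] H} (hT : IsCompactOperator T) :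
    IsCompactOperator (schur c A B T) := by
  have hcl : IsClosed {f : H →L[ℂ] H | IsCompactOperator f} :=
    isClosed_setOfPred_isCompactOperator
  refine hcl.mem_of_tendsto (hasSum_schurTerm hA hB hc T) (Eventually.of_forall fun s => ?_)
  exact (compactOperator (RingHom.id ℂ) H H).sum_mem fun i _ =>
    (compactOperator (RingHom.id ℂ) H H).smul_mem _ ((hT.comp_clm (A i)).clm_comp (B i).adjoint)

/-- The transpose of a Schur multiplication acts on the predual. -/
theorem exists_pairing_schur (hA : IsBessel A C) (hB : IsBessel B D)
    (hc : Tendsto c atTop (𝓝 0)) (q : lp (fun _ : ℕ => H) 2 × lp (fun _ : ℕ => H) 2) :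
    ∃ r, ∀ T : H →L[ℂ] H, pairing q (schur c A B T) = pairing r T := by
  obtain ⟨M, hM⟩ := (Metric.isBounded_range_of_tendsto c hc).exists_norm_le
  have hA' := hA.summable_prod (summable_norm_sq_lp q.1)
  have hB' := hB.summable_prod (summable_norm_sq_lp q.2)
  have hcA : Summable fun x : ℕ × ℕ => ‖(c x.2 : ℂ) • A x.2 (q.1 x.1)‖ ^ 2 := by
    refine Summable.of_nonneg_of_le (fun _ => by positivity) (fun x => ?_) (hA'.mul_left (M ^ 2))
    rw [norm_smul, mul_pow]
    gcongr
    simpa using hM _ ⟨x.2, rfl⟩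
  -- The double family, indexed by terms of `q` and terms of the multiplication, is square summable,
  -- so it defines a single predual functional.
  obtain ⟨r, hr⟩ := exists_pairing_of_equiv Nat.pairEquiv hcA hB'
  refine ⟨r, fun T => (hasSum_pairing q _).unique ?_⟩
  exact (hr T).prod_fiberwise fun j => hasSum_inner_schur hA hB hc T (q.1 j) (q.2 j)

end Schur

/-! ### Splitting off a null sequence. -/

/-- A summable sequence of nonnegative numbers stays summable after division by a suitable null
sequence. -/
theorem exists_tendsto_zero_summable_div {s : ℕ → ℝ} (hs : Summable s) (h0 : ∀ i, 0 ≤ s i) :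
    ∃ c : ℕ → ℝ, Tendsto c atTop (𝓝 0) ∧ (∀ i, c i = 0 → s i = 0) ∧
      Summable fun i => s i / c i ^ 2 := by
  set t : ℕ → ℝ := fun n => ∑' k, s (k + n) with ht
  have htn : ∀ n, 0 ≤ t n := fun n => tsum_nonneg fun k => h0 _
  have hstep : ∀ n, t n = s n + t (n + 1) := fun n => by
    have h := ((summable_nat_add_iff n).2 hs).tsum_eq_zero_add
    simp only [ht, h, zero_add]
    congr 1
    exact tsum_congr fun k => by congr 1; ring
  have htend : Tendsto t atTop (𝓝 0) := tendsto_sum_nat_add s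
  have hsqrt : Tendsto (fun n => √(t n)) atTop (𝓝 0) := by
    simpa using htend.sqrt
  -- The fourth root of the tail: `s n / √(t n) = (t n - t (n + 1)) / √(t n)` is at most `2 (√(t n)
  -- - √(t (n + 1)))`, which telescopes.
  refine ⟨fun n => √√(t n), by simpa using hsqrt.sqrt, fun i hi => ?_, ?_⟩
  · rw [Real.sqrt_eq_zero (Real.sqrt_nonneg _), Real.sqrt_eq_zero (htn i)] at hi
    linarith [hstep i, h0 i, htn (i + 1)]
  · have hle : ∀ n, s n / √√(t n) ^ 2 ≤ 2 * (√(t n) - √(t (n + 1))) := fun n => by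
      rw [Real.sq_sqrt (Real.sqrt_nonneg _)]
      have hmono : √(t (n + 1)) ≤ √(t n) := Real.sqrt_le_sqrt (by linarith [hstep n, h0 n])
      rcases (Real.sqrt_nonneg (t n)).eq_or_lt with h | h
      · rw [← h] at hmono ⊢
        simp only [div_zero]
        linarith
      · rw [div_le_iff₀ h]
        have h1 := Real.sq_sqrt (htn n)
        have h2 := Real.sq_sqrt (htn (n + 1))
        nlinarith [hstep n, sq_nonneg (√(t n) - √(t (n + 1)))]
    refine summable_of_sum_range_le (c := 2 * √(t 0))
      (fun n => div_nonneg (h0 n) (by positivity)) fun n => ?_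
    calc _ ≤ ∑ i ∈ Finset.range n, 2 * (√(t i) - √(t (i + 1))) :=
          Finset.sum_le_sum fun i _ => hle i
      _ = 2 * (√(t 0) - √(t n)) := by rw [← Finset.mul_sum, Finset.sum_range_sub']
      _ ≤ _ := by linarith [Real.sqrt_nonneg (t n)]

/-- A square summable sequence of vectors is the product of a null sequence and a square summable
sequence of vectors. -/
theorem exists_tendsto_zero_smul_eq {E : Type*} [NormedAddCommGroup E] [NormedSpace ℂ E]
    {f : ℕ → E} (hf : Summable fun i => ‖f i‖ ^ 2) :
    ∃ (c : ℕ → ℝ) (f' : ℕ → E), Tendsto c atTop (𝓝 0) ∧ (Summable fun i => ‖f' i‖ ^ 2) ∧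
      ∀ i, f i = (c i : ℂ) • f' i := by
  obtain ⟨c, hc, hc0, hs⟩ := exists_tendsto_zero_summable_div hf fun i => by positivity
  refine ⟨c, fun i => (c i : ℂ)⁻¹ • f i, hc, hs.congr fun i => ?_, fun i => ?_⟩
  · rw [norm_smul, mul_pow, norm_inv, inv_pow, Complex.norm_real, Real.norm_eq_abs, sq_abs]
    field_simp
  · by_cases h : c i = 0
    · have : f i = 0 := by simpa using hc0 i h
      simp [this]
    · rw [smul_smul, mul_inv_cancel₀ (by exact_mod_cast h), one_smul]

/-! ### Multiplication operators, cutoffs and truncations on `L²`. -/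

section L2

variable {X : Type*} [MeasurableSpace X] {μ : Measure X}

theorem enorm_sq_eq_lintegral (ξ : Lp ℂ 2 μ) : ‖ξ‖ₑ ^ 2 = ∫⁻ x, ‖ξ x‖ₑ ^ 2 ∂μ := by
  rw [Lp.enorm_def, eLpNorm_eq_lintegral_rpow_enorm_toReal (by norm_num) (by norm_num)]
  simp only [ENNReal.toReal_ofNat, ENNReal.rpow_ofNat]
  rw [← ENNReal.rpow_natCast, ← ENNReal.rpow_mul]
  norm_num

theorem adjoint_mulOp (a : Lp ℂ ∞ μ) : (mulOp μ a).adjoint = mulOp μ (star a) := by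
  symm
  rw [ContinuousLinearMap.eq_adjoint_iff]
  intro ξ η
  rw [L2.inner_def, L2.inner_def]
  refine integral_congr_ae ?_
  filter_upwards [coeFn_mulOp μ a η, coeFn_mulOp μ (star a) ξ, Lp.coeFn_star a] with x h1 h2 h3
  rw [h1, h2, h3]
  simp
  ring

/-- The multiplication by the indicator function of a set of finite measure. -/
def cutoff (μ : Measure X) {s : Set X} (hs : MeasurableSet s) (hμs : μ s ≠ ∞) :
    Lp ℂ 2 μ →L[ℂ] Lp ℂ 2 μ :=
  mulOp μ (indicatorConstLp ∞ hs hμs 1)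

theorem coeFn_cutoff {s : Set X} (hs : MeasurableSet s) (hμs : μ s ≠ ∞) (ξ : Lp ℂ 2 μ) :
    cutoff μ hs hμs ξ =ᵐ[μ] s.indicator ξ := by
  filter_upwards [coeFn_mulOp μ (indicatorConstLp ∞ hs hμs 1) ξ,
    indicatorConstLp_coeFn (p := ∞) (hs := hs) (hμs := hμs) (c := (1 : ℂ))] with x h1 h2
  rw [cutoff, h1, h2]
  by_cases hx : x ∈ s <;> simp [hx]

theorem norm_cutoff_apply_le {s : Set X} (hs : MeasurableSet s) (hμs : μ s ≠ ∞) (ξ : Lp ℂ 2 μ) :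
    ‖cutoff μ hs hμs ξ‖ ≤ ‖ξ‖ := by
  refine Lp.norm_le_norm_of_ae_le ?_
  filter_upwards [coeFn_cutoff hs hμs ξ] with x hx
  rw [hx]
  exact norm_indicator_le_norm_self _ _

theorem adjoint_cutoff {s : Set X} (hs : MeasurableSet s) (hμs : μ s ≠ ∞) :
    (cutoff μ hs hμs).adjoint = cutoff μ hs hμs := by
  rw [cutoff, adjoint_mulOp]
  congr 1
  refine Lp.ext ?_
  filter_upwards [Lp.coeFn_star (indicatorConstLp (μ := μ) ∞ hs hμs (1 : ℂ)),
    indicatorConstLp_coeFn (p := ∞) (hs := hs) (hμs := hμs) (c := (1 : ℂ))] with x h1 h2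
  rw [h1, Pi.star_apply, h2]
  by_cases hx : x ∈ s <;> simp [hx]

theorem inner_cutoff_comp {s t : Set X} (hs : MeasurableSet s) (hμs : μ s ≠ ∞)
    (ht : MeasurableSet t) (hμt : μ t ≠ ∞) (T : Lp ℂ 2 μ →L[ℂ] Lp ℂ 2 μ) (u v : Lp ℂ 2 μ) :
    ⟪v, (cutoff μ ht hμt ∘L T ∘L cutoff μ hs hμs) u⟫_ℂ =
      ⟪cutoff μ ht hμt v, T (cutoff μ hs hμs u)⟫_ℂ := by
  rw [← adjoint_cutoff ht hμt, ContinuousLinearMap.adjoint_inner_left, adjoint_cutoff]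
  rfl

theorem tendsto_cutoff {s : ℕ → Set X} (hs : ∀ n, MeasurableSet (s n)) (hμs : ∀ n, μ (s n) ≠ ∞)
    (hev : ∀ᵐ x ∂μ, ∀ᶠ n in atTop, x ∈ s n) (ξ : Lp ℂ 2 μ) :
    Tendsto (fun n => cutoff μ (hs n) (hμs n) ξ) atTop (𝓝 ξ) := by
  have h1 : ∀ n, ‖cutoff μ (hs n) (hμs n) ξ - ξ‖ₑ ^ 2 =
      ∫⁻ x, (s n)ᶜ.indicator (fun x => ‖ξ x‖ₑ ^ 2) x ∂μ := fun n => by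
    rw [enorm_sq_eq_lintegral]
    refine lintegral_congr_ae ?_
    filter_upwards [coeFn_cutoff (hs n) (hμs n) ξ, Lp.coeFn_sub (cutoff μ (hs n) (hμs n) ξ) ξ]
      with x hx hx'
    rw [hx', Pi.sub_apply, hx]
    by_cases h : x ∈ s n <;> simp [h]
  have hmeas : Measurable fun x => ‖ξ x‖ₑ ^ 2 :=
    (Lp.stronglyMeasurable ξ).measurable.enorm.pow_const 2
  have h2 : Tendsto (fun n => ‖cutoff μ (hs n) (hμs n) ξ - ξ‖ₑ ^ 2) atTop (𝓝 0) := by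
    simp only [h1]
    rw [← lintegral_zero (μ := μ)]
    refine tendsto_lintegral_of_dominated_convergence (fun x => ‖ξ x‖ₑ ^ 2)
      (fun n => hmeas.indicator (hs n).compl)
      (fun n => Eventually.of_forall fun x => Set.indicator_le_self _ _ x) ?_ ?_
    · rw [← enorm_sq_eq_lintegral]
      simp
    · filter_upwards [hev] with x hx
      refine tendsto_const_nhds.congr' ?_
      filter_upwards [hx] with n hn
      simp [hn]
  rw [tendsto_iff_norm_sub_tendsto_zero]
  have h3 := (ENNReal.tendsto_toReal ENNReal.zero_ne_top).comp h2
  simp only [Function.comp_def, ENNReal.toReal_pow, toReal_enorm, ENNReal.toReal_zero] at h3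
  simpa [Real.sqrt_sq (norm_nonneg _)] using h3.sqrt

/-- An operator with vanishing matrix coefficients between indicator functions is zero. -/
theorem eq_zero_of_inner_indicator {T : Lp ℂ 2 μ →L[ℂ] Lp ℂ 2 μ}
    (h : ∀ (s t : Set X) (hs : MeasurableSet s) (hμs : μ s ≠ ∞) (ht : MeasurableSet t)
      (hμt : μ t ≠ ∞), ⟪indicatorConstLp 2 ht hμt (1 : ℂ), T (indicatorConstLp 2 hs hμs 1)⟫_ℂ = 0) :
    T = 0 := by
  have key : ∀ L : Lp ℂ 2 μ →L[ℂ] ℂ,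
      (∀ (s : Set X) (hs : MeasurableSet s) (hμs : μ s ≠ ∞),
        L (indicatorConstLp 2 hs hμs 1) = 0) → L = 0 := by
    intro L hL
    ext ξ
    induction ξ using Lp.induction (p := 2) ENNReal.ofNat_ne_top with
    | @indicatorConst c s hs hμs =>
      have : ((Lp.simpleFunc.indicatorConst 2 hs hμs.ne c : Lp.simpleFunc ℂ 2 μ) : Lp ℂ 2 μ) =
          c • indicatorConstLp 2 hs hμs.ne (1 : ℂ) := by
        rw [Lp.simpleFunc.coe_indicatorConst]
        refine Lp.ext ?_
        filter_upwards [indicatorConstLp_coeFn (p := 2) (hs := hs) (hμs := hμs.ne) (c := c),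
          indicatorConstLp_coeFn (p := 2) (hs := hs) (hμs := hμs.ne) (c := (1 : ℂ)),
          Lp.coeFn_smul c (indicatorConstLp 2 hs hμs.ne (1 : ℂ))] with x h1 h2 h3
        rw [h1, h3, Pi.smul_apply, h2]
        by_cases hx : x ∈ s <;> simp [hx]
      rw [this, map_smul, hL]; simp
    | add hf hg _ h1 h2 => simpa [h1] using h2
    | isClosed => exact isClosed_eq L.continuous continuous_const
  ext1 ξ
  -- Density of simple functions is used once in each variable of the sesquilinear form.
  have h2 : innerSL ℂ (T ξ) = 0 := by
    refine key _ fun t ht hμt => ?_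
    have h3 : (innerSL ℂ (indicatorConstLp 2 ht hμt (1 : ℂ))) ∘L T = 0 :=
      key _ fun s hs hμs => h s t hs hμs ht hμt
    have h4 : ⟪indicatorConstLp 2 ht hμt (1 : ℂ), T ξ⟫_ℂ = 0 := DFunLike.congr_fun h3 ξ
    exact inner_eq_zero_symm.1 h4
  exact inner_self_eq_zero.1 (DFunLike.congr_fun h2 (T ξ))

/-- The sets on which the square function of `f` is bounded by `n`, cut down to finite measure. -/
def levelSet (μ : Measure X) [SigmaFinite μ] (f : ℕ → Lp ℂ 2 μ) (n : ℕ) : Set X :=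
  {x | ∑' i, ‖f i x‖ₑ ^ 2 ≤ n} ∩ spanningSets μ n

variable [SigmaFinite μ] {f : ℕ → Lp ℂ 2 μ}

omit [SigmaFinite μ] in
theorem measurable_squareFunction (f : ℕ → Lp ℂ 2 μ) :
    Measurable fun x => ∑' i, ‖f i x‖ₑ ^ 2 :=
  Measurable.tsum fun i => (Lp.stronglyMeasurable (f i)).measurable.enorm.pow_const 2

theorem measurableSet_levelSet (f : ℕ → Lp ℂ 2 μ) (n : ℕ) : MeasurableSet (levelSet μ f n) :=
  (measurableSet_le (measurable_squareFunction f) measurable_const).inter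
    (measurableSet_spanningSets μ n)

theorem measure_levelSet_ne_top (f : ℕ → Lp ℂ 2 μ) (n : ℕ) : μ (levelSet μ f n) ≠ ∞ :=
  ((measure_mono Set.inter_subset_right).trans_lt (measure_spanningSets_lt_top μ n)).ne

/-- The square function has integral `∑ ‖f i‖²`, so it is finite almost everywhere. -/
theorem ae_eventually_mem_levelSet (hf : Summable fun i => ‖f i‖ ^ 2) :
    ∀ᵐ x ∂μ, ∀ᶠ n in atTop, x ∈ levelSet μ f n := by
  have hint : ∫⁻ x, ∑' i, ‖f i x‖ₑ ^ 2 ∂μ ≠ ∞ := by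
    rw [lintegral_tsum fun i =>
      ((Lp.stronglyMeasurable (f i)).measurable.enorm.pow_const 2).aemeasurable]
    simp only [← enorm_sq_eq_lintegral]
    have := hf.tsum_ofReal_ne_top
    simpa only [ENNReal.ofReal_pow (norm_nonneg _), ofReal_norm] using this
  filter_upwards [ae_lt_top (measurable_squareFunction f) hint] with x hx
  obtain ⟨N, hN⟩ := ENNReal.exists_nat_gt hx.ne
  filter_upwards [eventually_ge_atTop N, eventually_ge_atTop (spanningSetsIndex μ x)] with n h1 h2
  exact ⟨hN.le.trans (by exact_mod_cast h1),
    monotone_spanningSets μ h2 (mem_spanningSetsIndex μ x)⟩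

theorem sum_enorm_sq_le_of_mem_levelSet {n : ℕ} {x : X} (hx : x ∈ levelSet μ f n)
    (s : Finset ℕ) : ∑ i ∈ s, ‖f i x‖ₑ ^ 2 ≤ n :=
  (ENNReal.sum_le_tsum s).trans hx.1

theorem memLp_indicator_levelSet (f : ℕ → Lp ℂ 2 μ) (n i : ℕ) :
    MemLp ((levelSet μ f n).indicator (f i)) ∞ μ := by
  refine memLp_top_of_bound ((Lp.aestronglyMeasurable (f i)).indicator
    (measurableSet_levelSet f n)) (√n) (Eventually.of_forall fun x => ?_)
  by_cases hx : x ∈ levelSet μ f n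
  · have h := sum_enorm_sq_le_of_mem_levelSet hx {i}
    rw [Finset.sum_singleton] at h
    have h2 := ENNReal.toReal_mono (ENNReal.natCast_ne_top n) h
    simp only [ENNReal.toReal_pow, toReal_enorm, ENNReal.toReal_natCast] at h2
    simpa [hx] using Real.le_sqrt_of_sq_le h2
  · simp [hx]

/-- The function `f i`, truncated to an essentially bounded one. -/
def truncation (f : ℕ → Lp ℂ 2 μ) (n i : ℕ) : Lp ℂ ∞ μ :=
  (memLp_indicator_levelSet f n i).toLp _

theorem coeFn_mulOp_truncation (f : ℕ → Lp ℂ 2 μ) (n i : ℕ) (ξ : Lp ℂ 2 μ) :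
    mulOp μ (truncation f n i) ξ =ᵐ[μ] fun x => (levelSet μ f n).indicator (f i) x * ξ x := by
  filter_upwards [coeFn_mulOp μ (truncation f n i) ξ, (memLp_indicator_levelSet f n i).coeFn_toLp]
    with x h1 h2
  rw [h1, truncation, h2]

/-- Summing the squared norms under the integral puts the square function, at most `n` on the level
set, in front of `‖ξ x‖²`. -/
theorem isBessel_truncation (f : ℕ → Lp ℂ 2 μ) (n : ℕ) :
    IsBessel (fun i => mulOp μ (truncation f n i)) n := by
  intro s ξ
  have h : ∑ i ∈ s, ‖mulOp μ (truncation f n i) ξ‖ₑ ^ 2 ≤ n * ‖ξ‖ₑ ^ 2 := by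
    have h1 : ∀ i, ‖mulOp μ (truncation f n i) ξ‖ₑ ^ 2 =
        ∫⁻ x, ‖(levelSet μ f n).indicator (f i) x‖ₑ ^ 2 * ‖ξ x‖ₑ ^ 2 ∂μ := fun i => by
      rw [enorm_sq_eq_lintegral]
      refine lintegral_congr_ae ?_
      filter_upwards [coeFn_mulOp_truncation f n i ξ] with x hx
      rw [hx, enorm_mul, mul_pow]
    simp only [h1]
    have hm : ∀ i, Measurable fun x => ‖(levelSet μ f n).indicator (f i) x‖ₑ ^ 2 := fun i =>
      ((Lp.stronglyMeasurable (f i)).measurable.indicator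
        (measurableSet_levelSet f n)).enorm.pow_const 2
    have hξ : Measurable fun x => ‖ξ x‖ₑ ^ 2 :=
      (Lp.stronglyMeasurable ξ).measurable.enorm.pow_const 2
    rw [← lintegral_finsetSum (f := fun i x =>
      ‖(levelSet μ f n).indicator (f i) x‖ₑ ^ 2 * ‖ξ x‖ₑ ^ 2) s
      fun i _ => (hm i).mul hξ, enorm_sq_eq_lintegral,
      ← lintegral_const_mul _ hξ]
    refine lintegral_mono fun x => ?_
    rw [← Finset.sum_mul]
    gcongr
    by_cases hx : x ∈ levelSet μ f n
    · simpa [hx] using sum_enorm_sq_le_of_mem_levelSet hx s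
    · simp [hx]
  have h2 := ENNReal.toReal_mono (by finiteness) h
  rw [ENNReal.toReal_sum fun i _ => by finiteness] at h2
  simpa using h2

/-- Multiplier and vector exchange roles here, which turns coefficients of the Schur multiplication
into terms of the functional. -/
theorem mulOp_truncation_indicator (f : ℕ → Lp ℂ 2 μ) (n i : ℕ) {s : Set X}
    (hs : MeasurableSet s) (hμs : μ s ≠ ∞) :
    mulOp μ (truncation f n i) (indicatorConstLp 2 hs hμs 1) =
      cutoff μ (hs.inter (measurableSet_levelSet f n))
        (measure_ne_top_of_subset Set.inter_subset_left hμs) (f i) := by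
  refine Lp.ext ?_
  filter_upwards [coeFn_mulOp_truncation f n i (indicatorConstLp 2 hs hμs 1),
    indicatorConstLp_coeFn (p := 2) (hs := hs) (hμs := hμs) (c := (1 : ℂ)),
    coeFn_cutoff (hs.inter (measurableSet_levelSet f n))
        (measure_ne_top_of_subset Set.inter_subset_left hμs) (f i)] with x h1 h2 h3
  rw [h1, h2, h3]
  by_cases hx : x ∈ s <;> by_cases hx' : x ∈ levelSet μ f n <;> simp [hx, hx']

end L2

/-! ### Masa-bimodules and the annihilation argument. -/

section Main

variable {X : Type*} [MeasurableSpace X] {μ : Measure X}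

/-- Two-sided multiplication has a transpose on the predual, which carries annihilators of `U` to
annihilators of `U`. -/
theorem IsMasaBimodule.weakStarClosure {U : Submodule ℂ (Lp ℂ 2 μ →L[ℂ] Lp ℂ 2 μ)}
    (hU : IsMasaBimodule μ U) : IsMasaBimodule μ (weakStarClosure U) := by
  intro T hT a b
  rw [mem_weakStarClosure_iff] at hT ⊢
  intro p hp
  let q : lp (fun _ : ℕ => Lp ℂ 2 μ) 2 × lp (fun _ : ℕ => Lp ℂ 2 μ) 2 :=
    (⟨_, memℓp_map (mulOp μ b) p.1⟩, ⟨_, memℓp_map (mulOp μ a).adjoint p.2⟩)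
  have hq : ∀ S, pairing q S = pairing p (mulOp μ a ∘L S ∘L mulOp μ b) := fun S =>
    tsum_congr fun i => ContinuousLinearMap.adjoint_inner_left _ _ _
  rw [← hq]
  exact hT q fun S hS => (hq S).trans (hp _ (hU S hS a b))

theorem IsMasaBimodule.sup {U V : Submodule ℂ (Lp ℂ 2 μ →L[ℂ] Lp ℂ 2 μ)}
    (hU : IsMasaBimodule μ U) (hV : IsMasaBimodule μ V) : IsMasaBimodule μ (U ⊔ V) := by
  intro T hT a b
  obtain ⟨S, hS, R, hR, rfl⟩ := Submodule.mem_sup.1 hT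
  rw [ContinuousLinearMap.add_comp, ContinuousLinearMap.comp_add]
  exact Submodule.add_mem_sup (hU S hS a b) (hV R hR a b)

variable [SigmaFinite μ]

/-- The matrix coefficients of the truncated Schur multiplication determined by a functional of
the predual. -/
theorem inner_schur_truncation {p : lp (fun _ : ℕ => Lp ℂ 2 μ) 2 × lp (fun _ : ℕ => Lp ℂ 2 μ) 2}
    {c : ℕ → ℝ} {f : ℕ → Lp ℂ 2 μ} (hc : Tendsto c atTop (𝓝 0))
    (hpf : ∀ i, p.1 i = (c i : ℂ) • f i) (n : ℕ) (T : Lp ℂ 2 μ →L[ℂ] Lp ℂ 2 μ) {s t : Set X}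
    (hs : MeasurableSet s) (hμs : μ s ≠ ∞) (ht : MeasurableSet t) (hμt : μ t ≠ ∞) :
    ⟪indicatorConstLp 2 ht hμt (1 : ℂ), schur c (fun i => mulOp μ (truncation f n i))
      (fun i => mulOp μ (truncation (fun i => p.2 i) n i)) T (indicatorConstLp 2 hs hμs 1)⟫_ℂ =
    pairing p (cutoff μ (ht.inter (measurableSet_levelSet (fun i => p.2 i) n))
        (measure_ne_top_of_subset Set.inter_subset_left hμt) ∘L T ∘L
      cutoff μ (hs.inter (measurableSet_levelSet f n))
        (measure_ne_top_of_subset Set.inter_subset_left hμs)) := by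
  have h := hasSum_inner_schur (isBessel_truncation f n)
    (isBessel_truncation (fun i => p.2 i) n) hc T (indicatorConstLp 2 hs hμs 1)
    (indicatorConstLp 2 ht hμt 1)
  refine h.unique ?_
  convert hasSum_pairing p _ using 2 with i
  rw [inner_cutoff_comp, hpf i, mulOp_truncation_indicator, mulOp_truncation_indicator,
    map_smul, map_smul, map_smul]

omit [SigmaFinite μ] in
theorem tendsto_pairing_cutoff (p : lp (fun _ : ℕ => Lp ℂ 2 μ) 2 × lp (fun _ : ℕ => Lp ℂ 2 μ) 2)
    {s t : ℕ → Set X} (hs : ∀ n, MeasurableSet (s n)) (hμs : ∀ n, μ (s n) ≠ ∞)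
    (hes : ∀ᵐ x ∂μ, ∀ᶠ n in atTop, x ∈ s n) (ht : ∀ n, MeasurableSet (t n))
    (hμt : ∀ n, μ (t n) ≠ ∞) (het : ∀ᵐ x ∂μ, ∀ᶠ n in atTop, x ∈ t n)
    (T : Lp ℂ 2 μ →L[ℂ] Lp ℂ 2 μ) :
    Tendsto (fun n => pairing p (cutoff μ (ht n) (hμt n) ∘L T ∘L cutoff μ (hs n) (hμs n))) atTop
      (𝓝 (pairing p T)) := by
  refine tendsto_tsum_of_dominated_convergence
    ((summable_norm_mul_norm p).mul_left ‖T‖) (fun i => ?_) (Eventually.of_forall fun n i => ?_)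
  · simp only [inner_cutoff_comp]
    exact (tendsto_cutoff ht hμt het _).inner
      ((T.continuous.tendsto _).comp (tendsto_cutoff hs hμs hes _))
  · rw [inner_cutoff_comp]
    refine (norm_inner_apply_le _ _ _).trans ?_
    gcongr <;> exact norm_cutoff_apply_le _ _ _

/-- A functional annihilating `U` annihilates the compact operators of the weak* closure of
`U + V`, if `V` contains no nonzero compact operator. -/
theorem pairing_eq_zero_of_isCompactOperator {U V : Submodule ℂ (Lp ℂ 2 μ →L[ℂ] Lp ℂ 2 μ)}
    (hU : IsMasaBimodule μ U) (hV : IsWeakStarClosedMasaBimodule μ V)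
    (hVc : ∀ T ∈ V, IsCompactOperator T → T = 0)
    {p : lp (fun _ : ℕ => Lp ℂ 2 μ) 2 × lp (fun _ : ℕ => Lp ℂ 2 μ) 2}
    (hp : ∀ T ∈ U, pairing p T = 0) {K : Lp ℂ 2 μ →L[ℂ] Lp ℂ 2 μ}
    (hK : K ∈ weakStarClosure (U ⊔ V)) (hKc : IsCompactOperator K) : pairing p K = 0 := by
  obtain ⟨c, f, hc, hf, hpf⟩ := exists_tendsto_zero_smul_eq (summable_norm_sq_lp p.1)
  set g : ℕ → Lp ℂ 2 μ := fun i => p.2 i with hg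
  have hA := fun n => isBessel_truncation f n
  have hB := fun n => isBessel_truncation g n
  have hzero : ∀ n, schur c (fun i => mulOp μ (truncation f n i))
      (fun i => mulOp μ (truncation g n i)) K = 0 := by
    intro n
    -- Membership in `V` is tested on `q` annihilating `V`; pulled back to `r`, it must vanish on
    -- `U` (killed by the multiplication) and on `V` (preserved by it).
    refine hVc _ (mem_of_isClosed_weakStar hV.isClosed fun q hq => ?_)
      (isCompactOperator_schur (hA n) (hB n) hc hKc)
    obtain ⟨r, hr⟩ := exists_pairing_schur (hA n) (hB n) hc q
    rw [hr]
    refine mem_weakStarClosure_iff.1 hK r fun T hT => ?_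
    obtain ⟨S, hS, R, hR, rfl⟩ := Submodule.mem_sup.1 hT
    have hS0 : pairing r S = 0 := by
      rw [← hr, eq_zero_of_inner_indicator (T := schur _ _ _ S), map_zero]
      intro s t hs hμs ht hμt
      rw [inner_schur_truncation hc hpf]
      exact hp _ (hU S hS _ _)
    have hR0 : pairing r R = 0 := by
      rw [← hr]
      refine pairing_eq_zero_of_hasSum q (hasSum_schurTerm (hA n) (hB n) hc R) fun i => hq _ ?_
      rw [schurTerm, adjoint_mulOp]
      exact V.smul_mem _ (hV.isMasaBimodule R hR _ _)
    rw [map_add, hS0, hR0, add_zero]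
  -- Each level set is intersected with itself to match `inner_schur_truncation`, applied with the
  -- level sets as test sets.
  have hmf := fun n => (measurableSet_levelSet f n).inter (measurableSet_levelSet f n)
  have hmg := fun n => (measurableSet_levelSet g n).inter (measurableSet_levelSet g n)
  refine tendsto_nhds_unique (tendsto_pairing_cutoff p hmf
    (fun n => measure_ne_top_of_subset Set.inter_subset_left (measure_levelSet_ne_top f n))
    (by simpa using ae_eventually_mem_levelSet hf) hmg
    (fun n => measure_ne_top_of_subset Set.inter_subset_left (measure_levelSet_ne_top g n))
    (by simpa using ae_eventually_mem_levelSet (summable_norm_sq_lp p.2)) K)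
    (tendsto_const_nhds.congr fun n => ?_)
  have h := inner_schur_truncation hc hpf n K (measurableSet_levelSet f n)
    (measure_levelSet_ne_top f n) (measurableSet_levelSet g n) (measure_levelSet_ne_top g n)
  rw [← h, hzero]
  simp

omit [SigmaFinite μ] in
theorem IsBimoduleOfUniqueness.eq_zero_of_isCompactOperator
    {U : Submodule ℂ (Lp ℂ 2 μ →L[ℂ] Lp ℂ 2 μ)} (hU : IsBimoduleOfUniqueness μ U)
    {T : Lp ℂ 2 μ →L[ℂ] Lp ℂ 2 μ} (hT : T ∈ U) (hTc : IsCompactOperator T) : T = 0 := by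
  by_contra h
  refine hU.not_multiplicity ⟨hU.toIsWeakStarClosedMasaBimodule, fun hbot => h ?_⟩
  exact (Submodule.mem_bot ℂ).1 (hbot ▸ ⟨hT, hTc⟩)

end Main

end MasaBimodule

end

theorem corollary4p3 {X : Type*} [MeasurableSpace X] [StandardBorelSpace X]
    (μ : Measure X) [SigmaFinite μ]
    (U V : Submodule ℂ (Lp ℂ 2 μ →L[ℂ] Lp ℂ 2 μ))
    (hU : MasaBimodule.IsBimoduleOfUniqueness μ U)
    (hV : MasaBimodule.IsBimoduleOfUniqueness μ V) :
    MasaBimodule.IsBimoduleOfUniqueness μ (MasaBimodule.weakStarClosure (U ⊔ V)) := by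
  refine ⟨⟨(hU.isMasaBimodule.sup hV.isMasaBimodule).weakStarClosure,
    MasaBimodule.isClosed_weakStarClosure _⟩, fun h => h.inf_compact_ne_bot ?_⟩
  refine (Submodule.eq_bot_iff _).2 fun K hK => ?_
  refine hU.eq_zero_of_isCompactOperator (MasaBimodule.mem_of_isClosed_weakStar hU.isClosed
    fun p hp => ?_) hK.2
  exact MasaBimodule.pairing_eq_zero_of_isCompactOperator hU.isMasaBimodule
    hV.toIsWeakStarClosedMasaBimodule (fun _ => hV.eq_zero_of_isCompactOperator) hp hK.1 hK.2
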